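/- Consider the Evans scenario with observed variables $A\in\{0,1,2\}$ and $B,C\in\{0,1\}$ and independent latent variables $\Lambda,M$, with arrows $\Lambda\to A$, $\Lambda\to B$, $M\to B$, $M\to C$, $B\to A$, $B\to C$. A function $p(a,b,c)$ has a classical model in this scenario if $$p(a,b,c)=\int\!\!\int p(a\mid b,\lambda)\,p(b\mid\lambda,\mu)\,p(c\mid b,\mu)\,dP_\Lambda(\lambda)\,dP_M(\mu)\qquad\text{for all } a,b,c,$$ for some probability spaces $(\Lambda,P_\Lambda)$, $(M,P_M)$ and measurable conditional probabilities $p(a\mid b,\lambda)$, $p(b\mid\lambda,\mu)$, $p(c\mid b,\mu)$ (for discrete latent variables the integrals are sums). Let $f(0,b)=0$, $f(1,b)=b$, $f(2,b)=b+1$, where all additions of bits are modulo $2$. Write $p_{abc}=p(a,b,c)$ and $$\begin{aligned} W(p)=\;&p_{000}^3/3 + p_{000}^2p_{011} + p_{000}^2p_{100} + p_{000}^2p_{110} + p_{000}^2p_{201} + p_{000}^2p_{211} \\ &\quad + p_{000}p_{011}^2 + p_{000}p_{211}^2 + 2p_{000}p_{011}p_{100} + p_{011}^3/3 + p_{011}^2p_{100}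 + p_{011}^2p_{110} \\ &\quad + 2p_{000}p_{011}p_{201} + 2p_{000}p_{011}p_{110} + p_{201}^2p_{211} + 2p_{000}p_{100}p_{110} + 2p_{000}p_{100}p_{201} + p_{201}p_{211}^2 \\ &\quad + 2p_{000}p_{100}p_{211} + p_{000}p_{110}^2 + p_{000}p_{100}^2 + 2p_{000}p_{110}p_{201} + 2p_{000}p_{110}p_{211} - 5p_{000}p_{201}^2/3 \\ &\quad + p_{011}^2p_{201} + p_{011}^2p_{211} + 2p_{000}p_{201}p_{211} + p_{011}p_{100}^2 + 2p_{011}p_{100}p_{110} + p_{110}p_{211}^2 \\ &\quad + 2p_{011}p_{100}p_{201} + 2p_{011}p_{100}p_{211} - p_{201}^3 + p_{011}p_{110}^2 + 14p_{011}p_{110}p_{201}/3 + 2p_{000}p_{011}p_{211} \\ &\quad + 2p_{011}p_{110}p_{211} + p_{011}p_{201}^2 + 2p_{011}p_{201}p_{211} + p_{011}p_{211}^2 + p_{100}^3/3 + p_{100}p_{211}^2 \\ &\quad + p_{110}^3/3 + p_{100}^2p_{110} + p_{100}^2p_{201} + p_{100}^2p_{211} + p_{211}^3/3 + p_{100}p_{110}^2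 \\ &\quad + 2p_{100}p_{110}p_{201} + 14p_{110}p_{201}p_{211}/3 + 2p_{100}p_{110}p_{211} - 5p_{100}p_{201}^2/3 + 2p_{100}p_{201}p_{211} + p_{110}^2p_{201} \\ &\quad + p_{110}^2p_{211} + p_{110}p_{201}^2. \end{aligned}$$ For a distribution $p$ let $p'(a,b,c)=p(\sigma(a),b+1,c+1)$, where $\sigma$ exchanges $1$ and $2$ and fixes $0$ (this relabelling preserves the condition $c=f(a,b)+b$). (i) Every $p$ that has a classical model in the Evans scenario and satisfies $p(c=f(a,b)+b)=1$, that is, $\sum_{a,b}p(a,b,f(a,b)+b)=1$, obeys $W(p)\le 1/3$ and $W(p')\le 1/3$. (ii) For a distribution $p_A$ on $\{0,1,2\}$ let $p(a,b,c)=p_A(a)\,p_{PR}(b,c\mid a)$ be the Bonet PR-box with input distribution $p_A$, where $p_{PR}(b,c\mid a)=1/2$ if $c=b+f(a,b)$ and $0$ otherwise. For $p_A=(10/21,10/21,1/21)$ this is a probability distribution, it satisfies $p(c=f(a,b)+b)=1$, it violates the first inequality with $W(p)-1/3=179/55566\approx 3.2\times10^{-3}$, and it has no classical model in the Evans scenario.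 (iii) For $p_A=(10/21,1/21,10/21)$ it is a probability distribution, it satisfies $p(c=f(a,b)+b)=1$, it violates the second inequality with $W(p')-1/3=179/55566\approx 3.2\times10^{-3}$, and it has no classical model in the Evans scenario. Here $\approx$ means that $|179/55566-3.2\times10^{-3}|\le 5\times10^{-5}$. -/

import Mathlib

/-- A classical causal model for the Evans scenario with `|A| = 3`, `|B| = |C| = 2`: the latent
variables `Λ → A, B` and `M → B, C` are independent random variables with values in arbitrary
measurable spaces, and there are arrows `B → A` and `B → C`. The observed variables are generated
by the conditional probabilities `p(a | b, l)`, `p(b | l, m)`, `p(c | b, m)`. -/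
structure EvansModel (L M : Type*) [MeasurableSpace L] [MeasurableSpace M] where
  /-- the law of the latent variable `Λ` -/
  lawL : MeasureTheory.ProbabilityMeasure L
  /-- the law of the latent variable `M` -/
  lawM : MeasureTheory.ProbabilityMeasure M
  /-- `condA a b l` is `p(a | b, l)` -/
  condA : Fin 3 → Fin 2 → L → ℝ
  /-- `condB b l m` is `p(b | l, m)` -/
  condB : Fin 2 → L → M → ℝ
  /-- `condC c b m` is `p(c | b, m)` -/
  condC : Fin 2 → Fin 2 → M → ℝ
  measurable_condA : ∀ a b, Measurable (condA a b)
  measurable_condB : ∀ b, Measurable (fun x : L × M => condB b x.1 x.2)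
  measurable_condC : ∀ c b, Measurable (condC c b)
  condA_nonneg : ∀ a b l, 0 ≤ condA a b l
  condB_nonneg : ∀ b l m, 0 ≤ condB b l m
  condC_nonneg : ∀ c b m, 0 ≤ condC c b m
  condA_sum : ∀ b l, ∑ a, condA a b l = 1
  condB_sum : ∀ l m, ∑ b, condB b l m = 1
  condC_sum : ∀ b m, ∑ c, condC c b m = 1

/-- The observed distribution of a classical model (the Markov condition of the Evans graph):
`p(a, b, c) = ∑_{l, m} p(l) p(m) p(a | b, l) p(b | l, m) p(c | b, m)`, with the sum over the latent
values replaced by the integral against the product of their laws. -/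
noncomputable def EvansModel.observed {L M : Type*} [MeasurableSpace L] [MeasurableSpace M]
    (E : EvansModel L M) (a : Fin 3) (b c : Fin 2) : ℝ :=
  ∫ x : L × M, E.condA a b x.1 * E.condB b x.1 x.2 * E.condC c b x.2
    ∂((E.lawL : MeasureTheory.Measure L).prod (E.lawM : MeasureTheory.Measure M))

/-- `p(a, b, c)` has a classical model in the Evans scenario. -/
def HasClassicalEvansModel.{u, v} (p : Fin 3 → Fin 2 → Fin 2 → ℝ) : Prop :=
  ∃ (L : Type u) (M : Type v) (_ : MeasurableSpace L) (_ : MeasurableSpace M)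
    (E : EvansModel L M), ∀ a b c, p a b c = E.observed a b c

/-- `p(a, b, c)` is a probability distribution. -/
def IsProbDist (p : Fin 3 → Fin 2 → Fin 2 → ℝ) : Prop :=
  (∀ a b c, 0 ≤ p a b c) ∧ ∑ a, ∑ b, ∑ c, p a b c = 1

/-- `f(0, b) = 0`, `f(1, b) = b`, `f(2, b) = b + 1 mod 2`. -/
def bonetF (a : Fin 3) (b : Fin 2) : Fin 2 :=
  ![0, b, b + 1] a

/-- The condition `p(c = f(a, b) + b) = 1` (addition in `Fin 2` is modulo 2). -/
def SupportedOnBonet (p : Fin 3 → Fin 2 → Fin 2 → ℝ) : Prop :=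
  ∑ a, ∑ b, p a b (bonetF a b + b) = 1

/-- The Bonet PR-box `p(b, c | a)`. -/
noncomputable def bonetBox (b c : Fin 2) (a : Fin 3) : ℝ :=
  if c = b + bonetF a b then 1 / 2 else 0

/-- The Bonet PR-box with input distribution `pA`: `p(a, b, c) = pA(a) p(b, c | a)`. -/
noncomputable def bonetDist (pA : Fin 3 → ℝ) (a : Fin 3) (b c : Fin 2) : ℝ :=
  pA a * bonetBox b c a

/-- The relabelling that exchanges the outcomes `1` and `2` of `A` and flips `B` and `C`.
It preserves the condition `c = f(a, b) + b`. -/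
def relabel (p : Fin 3 → Fin 2 → Fin 2 → ℝ) (a : Fin 3) (b c : Fin 2) : ℝ :=
  p (Equiv.swap 1 2 a) (b + 1) (c + 1)

/-- The left-hand side of the cubic inequality. -/
noncomputable def cubicWitness (p : Fin 3 → Fin 2 → Fin 2 → ℝ) : ℝ :=
    p 0 0 0 ^ 3 / 3 + p 0 0 0 ^ 2 * p 0 1 1 + p 0 0 0 ^ 2 * p 1 0 0 + p 0 0 0 ^ 2 * p 1 1 0 +
    p 0 0 0 ^ 2 * p 2 0 1 + p 0 0 0 ^ 2 * p 2 1 1 + p 0 0 0 * p 0 1 1 ^ 2 +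
    p 0 0 0 * p 2 1 1 ^ 2 + 2 * p 0 0 0 * p 0 1 1 * p 1 0 0 + p 0 1 1 ^ 3 / 3 +
    p 0 1 1 ^ 2 * p 1 0 0 + p 0 1 1 ^ 2 * p 1 1 0 + 2 * p 0 0 0 * p 0 1 1 * p 2 0 1 +
    2 * p 0 0 0 * p 0 1 1 * p 1 1 0 + p 2 0 1 ^ 2 * p 2 1 1 +
    2 * p 0 0 0 * p 1 0 0 * p 1 1 0 + 2 * p 0 0 0 * p 1 0 0 * p 2 0 1 +
    p 2 0 1 * p 2 1 1 ^ 2 + 2 * p 0 0 0 * p 1 0 0 * p 2 1 1 + p 0 0 0 * p 1 1 0 ^ 2 +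
    p 0 0 0 * p 1 0 0 ^ 2 + 2 * p 0 0 0 * p 1 1 0 * p 2 0 1 +
    2 * p 0 0 0 * p 1 1 0 * p 2 1 1 - 5 * p 0 0 0 * p 2 0 1 ^ 2 / 3 +
    p 0 1 1 ^ 2 * p 2 0 1 + p 0 1 1 ^ 2 * p 2 1 1 + 2 * p 0 0 0 * p 2 0 1 * p 2 1 1 +
    p 0 1 1 * p 1 0 0 ^ 2 + 2 * p 0 1 1 * p 1 0 0 * p 1 1 0 + p 1 1 0 * p 2 1 1 ^ 2 +
    2 * p 0 1 1 * p 1 0 0 * p 2 0 1 + 2 * p 0 1 1 * p 1 0 0 * p 2 1 1 - p 2 0 1 ^ 3 +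
    p 0 1 1 * p 1 1 0 ^ 2 + 14 * p 0 1 1 * p 1 1 0 * p 2 0 1 / 3 +
    2 * p 0 0 0 * p 0 1 1 * p 2 1 1 + 2 * p 0 1 1 * p 1 1 0 * p 2 1 1 +
    p 0 1 1 * p 2 0 1 ^ 2 + 2 * p 0 1 1 * p 2 0 1 * p 2 1 1 + p 0 1 1 * p 2 1 1 ^ 2 +
    p 1 0 0 ^ 3 / 3 + p 1 0 0 * p 2 1 1 ^ 2 + p 1 1 0 ^ 3 / 3 + p 1 0 0 ^ 2 * p 1 1 0 +
    p 1 0 0 ^ 2 * p 2 0 1 + p 1 0 0 ^ 2 * p 2 1 1 + p 2 1 1 ^ 3 / 3 +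
    p 1 0 0 * p 1 1 0 ^ 2 + 2 * p 1 0 0 * p 1 1 0 * p 2 0 1 +
    14 * p 1 1 0 * p 2 0 1 * p 2 1 1 / 3 + 2 * p 1 0 0 * p 1 1 0 * p 2 1 1 -
    5 * p 1 0 0 * p 2 0 1 ^ 2 / 3 + 2 * p 1 0 0 * p 2 0 1 * p 2 1 1 +
    p 1 1 0 ^ 2 * p 2 0 1 + p 1 1 0 ^ 2 * p 2 1 1 + p 1 1 0 * p 2 0 1 ^ 2

universe u v

open MeasureTheory

/-! The support condition says that `c = 1` iff `a = 2` when `b = 0`, and `c = 1` iff `a ≠ 1` when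
`b = 1`. Given `(l, m, b)` the outcomes `a` and `c` are independent, so wherever `b` has positive
probability both sides of the equivalence are deterministic and agree (`EvansModel.ae_agree`). Hence
`l` and `m` each get a two-bit type, the value of `c` announced for `b = 0` and for `b = 1`, and `b`
can occur only if the two types agree in bit `b`. Opposite types therefore almost never meet, and
types differing in one bit force `b`. This bounds the distribution of `(b, c)` by products of type
masses. With `u, z` the probabilities of `(b, c) = (0, 0), (0, 1)` and `w, v` those of `(1, 0), (1,
1)`, the bounds give `z * (z ^ 2 + 2 * u * z - 2 * v * w) ≥ 0` (`cubic_nonneg_of_type_masses`). On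
the support this is the cubic inequality (`cubicWitness_eq`). The PR-boxes violate it by direct
evaluation, the second after relabelling. -/

lemma supportedOnBonet_iff {p : Fin 3 → Fin 2 → Fin 2 → ℝ} : SupportedOnBonet p ↔
    p 0 0 0 + p 0 1 1 + (p 1 0 0 + p 1 1 0) + (p 2 0 1 + p 2 1 1) = 1 := by
  simp only [SupportedOnBonet, Fin.sum_univ_three, Fin.sum_univ_two]
  rfl

/-- Independent outcomes `a` and `c` for which `a = 0` holds exactly if `c = 1` are
deterministic. -/
lemma agree_of_or_eq_zero {a₀ a₁ a₂ c₀ c₁ : ℝ} (hc : c₀ + c₁ = 1) (ha : a₀ + a₁ + a₂ = 1)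
    (h₀ : a₀ = 0 ∨ c₀ = 0) (h₁ : a₁ = 0 ∨ c₁ = 0) (h₂ : a₂ = 0 ∨ c₁ = 0) :
    (a₀ = 1 ∧ c₁ = 1) ∨ (a₀ = 0 ∧ c₁ = 0) := by
  by_cases hc₁ : c₁ = 0
  · exact Or.inr ⟨h₀.resolve_right fun h => by linarith, hc₁⟩
  · have ha₁ := h₁.resolve_right hc₁
    have ha₂ := h₂.resolve_right hc₁
    have ha₀ : a₀ = 1 := by linarith
    have hc₀ : c₀ = 0 := h₀.resolve_left (by simp [ha₀])
    exact Or.inl ⟨ha₀, by linarith⟩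

/-! ### Almost sure agreement of the latent types -/

namespace EvansModel

variable {L M : Type*} [MeasurableSpace L] [MeasurableSpace M] (E : EvansModel L M)

/-- The product law of the two latent variables. -/
noncomputable abbrev law : Measure (L × M) := (E.lawL : Measure L).prod (E.lawM : Measure M)

/-- The integrand `p(a | b, l) p(b | l, m) p(c | b, m)` of the observed distribution. -/
def joint (a : Fin 3) (b c : Fin 2) (x : L × M) : ℝ :=
  E.condA a b x.1 * E.condB b x.1 x.2 * E.condC c b x.2

lemma observed_eq (a : Fin 3) (b c : Fin 2) : E.observed a b c = ∫ x, E.joint a b c x ∂E.law := rfl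

lemma condA_le_one (a : Fin 3) (b : Fin 2) (l : L) : E.condA a b l ≤ 1 := by
  rw [← E.condA_sum b l]
  exact Finset.single_le_sum (fun i _ => E.condA_nonneg i b l) (Finset.mem_univ a)

lemma condB_le_one (b : Fin 2) (l : L) (m : M) : E.condB b l m ≤ 1 := by
  rw [← E.condB_sum l m]
  exact Finset.single_le_sum (fun i _ => E.condB_nonneg i l m) (Finset.mem_univ b)

lemma condC_le_one (c b : Fin 2) (m : M) : E.condC c b m ≤ 1 := by
  rw [← E.condC_sum b m]
  exact Finset.single_le_sum (fun i _ => E.condC_nonneg i b m) (Finset.mem_univ c)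

lemma joint_nonneg (a : Fin 3) (b c : Fin 2) (x : L × M) : 0 ≤ E.joint a b c x :=
  mul_nonneg (mul_nonneg (E.condA_nonneg ..) (E.condB_nonneg ..)) (E.condC_nonneg ..)

lemma sum_joint (x : L × M) : ∑ a, ∑ b, ∑ c, E.joint a b c x = 1 := by
  simp only [joint, ← Finset.mul_sum, E.condC_sum, mul_one]
  rw [Finset.sum_comm]
  simp only [← Finset.sum_mul, E.condA_sum, one_mul, E.condB_sum]

lemma joint_le_one (a : Fin 3) (b c : Fin 2) (x : L × M) : E.joint a b c x ≤ 1 :=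
  mul_le_one₀ (mul_le_one₀ (E.condA_le_one ..) (E.condB_nonneg ..) (E.condB_le_one ..))
    (E.condC_nonneg ..) (E.condC_le_one ..)

lemma measurable_joint (a : Fin 3) (b c : Fin 2) : Measurable (E.joint a b c) :=
  (((E.measurable_condA a b).comp measurable_fst).mul (E.measurable_condB b)).mul
    ((E.measurable_condC c b).comp measurable_snd)

lemma integrable_joint (a : Fin 3) (b c : Fin 2) : Integrable (E.joint a b c) E.law :=
  Integrable.of_bound (E.measurable_joint a b c).aestronglyMeasurable 1 <| .of_forall fun x => by
    rw [Real.norm_of_nonneg (E.joint_nonneg a b c x)]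
    exact E.joint_le_one a b c x

lemma observed_nonneg (a : Fin 3) (b c : Fin 2) : 0 ≤ E.observed a b c :=
  integral_nonneg (E.joint_nonneg a b c)

lemma sum_observed : ∑ a, ∑ b, ∑ c, E.observed a b c = 1 := by
  have h : ∫ x, ∑ a, ∑ b, ∑ c, E.joint a b c x ∂E.law = 1 := by
    simp_rw [E.sum_joint]
    simp
  rw [integral_finsetSum _ fun a _ => integrable_finsetSum _ fun b _ =>
    integrable_finsetSum _ fun c _ => E.integrable_joint a b c] at h
  rw [← h]
  refine Finset.sum_congr rfl fun a _ => ?_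
  rw [integral_finsetSum _ fun b _ => integrable_finsetSum _ fun c _ => E.integrable_joint a b c]
  refine Finset.sum_congr rfl fun b _ => ?_
  rw [integral_finsetSum _ fun c _ => E.integrable_joint a b c]
  rfl

lemma joint_ae_eq_zero {a : Fin 3} {b c : Fin 2} (h : E.observed a b c = 0) :
    ∀ᵐ x ∂E.law, E.joint a b c x = 0 :=
  (integral_eq_zero_iff_of_nonneg (E.joint_nonneg a b c) (E.integrable_joint a b c)).1 h

/-- The values of `l` that produce `a = 2` (hence `c = 1`) when `b = 0`. -/
def setL₀ : Set L := {l | E.condA 2 0 l = 1}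

/-- The values of `l` that produce `a ≠ 1` (hence `c = 1`) when `b = 1`. -/
def setL₁ : Set L := {l | E.condA 1 1 l = 0}

/-- The values of `m` that produce `c = 1` when `b` is given. -/
def setM (b : Fin 2) : Set M := {m | E.condC 1 b m = 1}

lemma measurableSet_setL₀ : MeasurableSet E.setL₀ :=
  E.measurable_condA 2 0 (measurableSet_singleton 1)

lemma measurableSet_setL₁ : MeasurableSet E.setL₁ :=
  E.measurable_condA 1 1 (measurableSet_singleton 0)

lemma measurableSet_setM (b : Fin 2) : MeasurableSet (E.setM b) :=
  E.measurable_condC 1 b (measurableSet_singleton 1)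

/-- If the observed distribution is supported on `c = f(a, b) + b`, then almost surely `l` and `m`
agree on the value of `c` for each value of `b` that has positive probability. -/
lemma ae_agree (h : SupportedOnBonet E.observed) : ∀ᵐ x ∂E.law,
    (E.condB 0 x.1 x.2 = 0 ∨
      (x.1 ∈ E.setL₀ ∧ x.2 ∈ E.setM 0 ∧ E.condA 2 0 x.1 = 1 ∧ E.condC 1 0 x.2 = 1) ∨
      (x.1 ∉ E.setL₀ ∧ x.2 ∉ E.setM 0 ∧ E.condA 2 0 x.1 = 0 ∧ E.condC 1 0 x.2 = 0)) ∧
    (E.condB 1 x.1 x.2 = 0 ∨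
      (x.1 ∈ E.setL₁ ∧ x.2 ∈ E.setM 1 ∧ E.condA 1 1 x.1 = 0 ∧ E.condC 1 1 x.2 = 1) ∨
      (x.1 ∉ E.setL₁ ∧ x.2 ∉ E.setM 1 ∧ E.condA 1 1 x.1 = 1 ∧ E.condC 1 1 x.2 = 0)) := by
  have hs := E.sum_observed
  rw [supportedOnBonet_iff] at h
  simp only [Fin.sum_univ_three, Fin.sum_univ_two] at hs
  have hn := E.observed_nonneg
  -- The six supported entries already exhaust the total mass 1.
  obtain ⟨z1, z2, z3, z4, z5, z6⟩ : E.observed 0 0 1 = 0 ∧ E.observed 0 1 0 = 0 ∧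
      E.observed 1 0 1 = 0 ∧ E.observed 1 1 1 = 0 ∧ E.observed 2 0 0 = 0 ∧
      E.observed 2 1 0 = 0 := by
    refine ⟨?_, ?_, ?_, ?_, ?_, ?_⟩ <;>
    linarith [hn 0 0 1, hn 0 1 0, hn 1 0 1, hn 1 1 1, hn 2 0 0, hn 2 1 0]
  filter_upwards [E.joint_ae_eq_zero z1, E.joint_ae_eq_zero z2, E.joint_ae_eq_zero z3,
    E.joint_ae_eq_zero z4, E.joint_ae_eq_zero z5, E.joint_ae_eq_zero z6] with x h1 h2 h3 h4 h5 h6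
  have sA0 := E.condA_sum 0 x.1
  have sA1 := E.condA_sum 1 x.1
  have sC0 := E.condC_sum 0 x.2
  have sC1 := E.condC_sum 1 x.2
  simp only [Fin.sum_univ_three, Fin.sum_univ_two] at sA0 sA1 sC0 sC1
  simp only [joint, mul_eq_zero] at h1 h2 h3 h4 h5 h6
  simp only [setL₀, setL₁, setM, Set.mem_ofPred_eq]
  refine ⟨or_iff_not_imp_left.2 fun hb => ?_, or_iff_not_imp_left.2 fun hb => ?_⟩
  · simp only [hb, or_false] at h1 h3 h5
    rcases agree_of_or_eq_zero sC0 (by linarith [sA0] : E.condA 2 0 x.1 +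
      E.condA 0 0 x.1 + E.condA 1 0 x.1 = 1) h5 h1 h3 with ⟨h, h'⟩ | ⟨h, h'⟩
    · exact Or.inl ⟨h, h', h, h'⟩
    · exact Or.inr ⟨by simp [h], by simp [h'], h, h'⟩
  · simp only [hb, or_false] at h2 h4 h6
    -- For `b = 1` the distinguished event is `a = 1`, which matches `c = 0`, so the two values of
    -- `c` trade places.
    rcases agree_of_or_eq_zero (by linarith : E.condC 1 1 x.2 + E.condC 0 1 x.2 = 1)
      (by linarith [sA1] : E.condA 1 1 x.1 + E.condA 0 1 x.1 + E.condA 2 1 x.1 = 1) h4 h2 h6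
      with ⟨h, h'⟩ | ⟨h, h'⟩
    · have hC : E.condC 1 1 x.2 = 0 := by linarith
      exact Or.inr ⟨by simp [h], by simp [hC], h, hC⟩
    · have hC : E.condC 1 1 x.2 = 1 := by linarith
      exact Or.inl ⟨h, hC, h, hC⟩

end EvansModel

/-! ### Type masses and the cubic inequality -/

lemma integral_le_measureReal_of_ae_le_indicator {X : Type*} [MeasurableSpace X] {μ : Measure X}
    [IsFiniteMeasure μ] {f : X → ℝ} (hf : Integrable f μ) {s : Set X} (hs : MeasurableSet s)
    (h : ∀ᵐ x ∂μ, f x ≤ s.indicator 1 x) : ∫ x, f x ∂μ ≤ μ.real s := by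
  rw [← integral_indicator_one hs]
  exact integral_mono_ae hf ((integrable_const (1 : ℝ)).indicator hs) h

lemma measureReal_le_integral_of_ae_indicator_le {X : Type*} [MeasurableSpace X] {μ : Measure X}
    [IsFiniteMeasure μ] {f : X → ℝ} (hf : Integrable f μ) {s : Set X} (hs : MeasurableSet s)
    (h : ∀ᵐ x ∂μ, s.indicator 1 x ≤ f x) : μ.real s ≤ ∫ x, f x ∂μ := by
  rw [← integral_indicator_one hs]
  exact integral_mono_ae ((integrable_const (1 : ℝ)).indicator hs) hf h

/-- The inequality for the masses `l i j`, `m i j` of the four types of `l` and of `m`, where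
opposite types never occur together. -/
lemma cubic_nonneg_of_type_masses
    {l₀₀ l₀₁ l₁₀ l₁₁ m₀₀ m₀₁ m₁₀ m₁₁ u v w z : ℝ}
    (hl₀₀ : 0 ≤ l₀₀) (hl₀₁ : 0 ≤ l₀₁) (hl₁₀ : 0 ≤ l₁₀) (hl₁₁ : 0 ≤ l₁₁)
    (hm₀₀ : 0 ≤ m₀₀) (hm₀₁ : 0 ≤ m₀₁) (hm₁₀ : 0 ≤ m₁₀) (hm₁₁ : 0 ≤ m₁₁)
    (h₀₀ : l₀₀ * m₁₁ = 0) (h₀₁ : l₀₁ * m₁₀ = 0) (h₁₀ : l₁₀ * m₀₁ = 0) (h₁₁ : l₁₁ * m₀₀ = 0)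
    (hw : 0 ≤ w)
    (hu : l₀₀ * m₀₁ + l₀₁ * m₀₀ ≤ u) (hz : l₁₁ * m₁₀ + l₁₀ * m₁₁ ≤ z)
    (hz' : z ≤ (l₁₁ + l₁₀) * (m₁₁ + m₁₀))
    (hv' : v ≤ (l₁₁ + l₀₁) * (m₁₁ + m₀₁)) (hw' : w ≤ (l₁₀ + l₀₀) * (m₁₀ + m₀₀)) :
    0 ≤ z * (z ^ 2 + 2 * u * z - 2 * v * w) := by
  have hz0 : 0 ≤ z := le_trans (by positivity) hz
  have hu0 : 0 ≤ u := le_trans (by positivity) hu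
  have hvw : v * w ≤ (l₁₁ + l₀₁) * (m₁₁ + m₀₁) * ((l₁₀ + l₀₀) * (m₁₀ + m₀₀)) :=
    mul_le_mul hv' hw' hw (by positivity)
  have huz : (l₀₀ * m₀₁ + l₀₁ * m₀₀) * (l₁₁ * m₁₀ + l₁₀ * m₁₁) ≤ u * z :=
    mul_le_mul hu hz (by positivity) hu0
  have hzz : (l₁₁ * m₁₀ + l₁₀ * m₁₁) ^ 2 ≤ z ^ 2 := pow_le_pow_left₀ (by positivity) hz 2
  have hsq := sq_nonneg (l₁₁ * m₁₀ - l₁₀ * m₁₁)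
  have huz0 := mul_nonneg hu0 hz0
  have hzz0 := sq_nonneg z
  -- Each null product has a vanishing factor. In the resulting 16 cases either `z = 0`, or the
  -- bound on `v * w` vanishes, or it is a single monomial: `l₁₀ * l₁₁ * m₁₀ * m₁₁` is absorbed by
  -- `z ^ 2`, while `l₀₀ * l₁₁ * m₀₁ * m₁₀` and `l₀₁ * l₁₀ * m₀₀ * m₁₁` are absorbed by `u * z`.
  have key : z = 0 ∨ 2 * (v * w) ≤ z ^ 2 + 2 * (u * z) := by
    rcases mul_eq_zero.1 h₀₀ with rfl | rfl <;> rcases mul_eq_zero.1 h₀₁ with rfl | rfl <;>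
    rcases mul_eq_zero.1 h₁₀ with rfl | rfl <;> rcases mul_eq_zero.1 h₁₁ with rfl | rfl <;>
    first
    | (left; apply le_antisymm _ hz0; linarith)
    | (right; linarith)
  rcases key with rfl | key
  · simp
  · exact mul_nonneg hz0 (by linarith)

/-- On distributions supported on `c = f(a, b) + b`, the cubic inequality is an inequality
for the distribution of `(b, c)`. -/
lemma cubicWitness_eq {p : Fin 3 → Fin 2 → Fin 2 → ℝ} (h : SupportedOnBonet p) :
    cubicWitness p = 1 / 3 - 4 / 3 * (p 2 0 1 * (p 2 0 1 ^ 2 + 2 * (p 0 0 0 + p 1 0 0) * p 2 0 1 -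
      2 * (p 0 1 1 + p 2 1 1) * p 1 1 0)) := by
  rw [supportedOnBonet_iff] at h
  -- Homogenising the constant turns the claim into an identity of cubic forms.
  have h3 : (1 : ℝ) / 3 =
      (p 0 0 0 + p 0 1 1 + (p 1 0 0 + p 1 1 0) + (p 2 0 1 + p 2 1 1)) ^ 3 / 3 := by
    rw [h]; norm_num
  rw [h3, cubicWitness]
  ring

lemma EvansModel.cubicWitness_observed_le {L M : Type*} [MeasurableSpace L] [MeasurableSpace M]
    (E : EvansModel L M) (h : SupportedOnBonet E.observed) : cubicWitness E.observed ≤ 1 / 3 := by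
  rw [cubicWitness_eq h]
  have hae := E.ae_agree h
  have mL₀ := E.measurableSet_setL₀
  have mL₁ := E.measurableSet_setL₁
  have mM₀ := E.measurableSet_setM 0
  have mM₁ := E.measurableSet_setM 1
  have rect (s : Set L) (t : Set M) : E.law.real (s ×ˢ t) =
      (E.lawL : Measure L).real s * (E.lawM : Measure M).real t := measureReal_prod_prod s t
  have sumB (x : L × M) : E.condB 0 x.1 x.2 + E.condB 1 x.1 x.2 = 1 := by
    simpa [Fin.sum_univ_two] using E.condB_sum x.1 x.2
  have sumC (b : Fin 2) (m : M) : E.condC 0 b m + E.condC 1 b m = 1 := by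
    simpa [Fin.sum_univ_two] using E.condC_sum b m
  have sumA (b : Fin 2) (l : L) : E.condA 0 b l + E.condA 1 b l + E.condA 2 b l = 1 := by
    simpa [Fin.sum_univ_three] using E.condA_sum b l
  have null (s : Set L) (t : Set M) (hst : ∀ᵐ x ∂E.law, ¬ (x.1 ∈ s ∧ x.2 ∈ t)) :
      (E.lawL : Measure L).real s * (E.lawM : Measure M).real t = 0 := by
    have h0 : E.law (s ×ˢ t) = 0 := measure_eq_zero_iff_ae_notMem.2 hst
    rw [← rect, measureReal_def, h0, ENNReal.toReal_zero]
  have splitL (s t : Set L) (ht : MeasurableSet t) : (E.lawL : Measure L).real s =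
      (E.lawL : Measure L).real (s ∩ t) + (E.lawL : Measure L).real (s ∩ tᶜ) :=
    (measureReal_inter_add_sdiff ht).symm
  have splitM (s t : Set M) (ht : MeasurableSet t) : (E.lawM : Measure M).real s =
      (E.lawM : Measure M).real (s ∩ t) + (E.lawM : Measure M).real (s ∩ tᶜ) :=
    (measureReal_inter_add_sdiff ht).symm
  have hu : E.observed 0 0 0 + E.observed 1 0 0 =
      ∫ x, E.joint 0 0 0 x + E.joint 1 0 0 x ∂E.law :=
    (integral_add (E.integrable_joint ..) (E.integrable_joint ..)).symm
  have hv : E.observed 0 1 1 + E.observed 2 1 1 =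
      ∫ x, E.joint 0 1 1 x + E.joint 2 1 1 x ∂E.law :=
    (integral_add (E.integrable_joint ..) (E.integrable_joint ..)).symm
  have hcubic := cubic_nonneg_of_type_masses
    (l₀₀ := (E.lawL : Measure L).real (E.setL₀ᶜ ∩ E.setL₁ᶜ))
    (l₀₁ := (E.lawL : Measure L).real (E.setL₀ᶜ ∩ E.setL₁))
    (l₁₀ := (E.lawL : Measure L).real (E.setL₀ ∩ E.setL₁ᶜ))
    (l₁₁ := (E.lawL : Measure L).real (E.setL₀ ∩ E.setL₁))
    (m₀₀ := (E.lawM : Measure M).real ((E.setM 0)ᶜ ∩ (E.setM 1)ᶜ))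
    (m₀₁ := (E.lawM : Measure M).real ((E.setM 0)ᶜ ∩ E.setM 1))
    (m₁₀ := (E.lawM : Measure M).real (E.setM 0 ∩ (E.setM 1)ᶜ))
    (m₁₁ := (E.lawM : Measure M).real (E.setM 0 ∩ E.setM 1))
    (u := E.observed 0 0 0 + E.observed 1 0 0) (v := E.observed 0 1 1 + E.observed 2 1 1)
    (w := E.observed 1 1 0) (z := E.observed 2 0 1)
    measureReal_nonneg measureReal_nonneg measureReal_nonneg measureReal_nonneg
    measureReal_nonneg measureReal_nonneg measureReal_nonneg measureReal_nonneg
    ?_ ?_ ?_ ?_ (E.observed_nonneg ..)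
    ?_ ?_ ?_ ?_ ?_
  · linarith
  -- Opposite types would exclude both values of `b`, against `sumB`; likewise in the next three
  -- goals.
  · refine null _ _ ?_
    filter_upwards [hae] with x hx
    have := sumB x
    simp only [Set.mem_inter_iff, Set.mem_compl_iff]
    grind
  · refine null _ _ ?_
    filter_upwards [hae] with x hx
    have := sumB x
    simp only [Set.mem_inter_iff, Set.mem_compl_iff]
    grind
  · refine null _ _ ?_
    filter_upwards [hae] with x hx
    have := sumB x
    simp only [Set.mem_inter_iff, Set.mem_compl_iff]
    grind
  · refine null _ _ ?_
    filter_upwards [hae] with x hx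
    have := sumB x
    simp only [Set.mem_inter_iff, Set.mem_compl_iff]
    grind
  -- On these rectangles the types share bit 0, equal to 0, and differ in bit 1: this forces `b = 0`
  -- and `c = 0`.
  · rw [hu, ← rect, ← rect,
      ← measureReal_union (Set.disjoint_left.2 fun x hx hy => hx.1.2 hy.1.2)
      ((mL₀.compl.inter mL₁).prod (mM₀.compl.inter mM₁.compl))]
    refine measureReal_le_integral_of_ae_indicator_le
      ((E.integrable_joint ..).add (E.integrable_joint ..))
      (((mL₀.compl.inter mL₁.compl).prod (mM₀.compl.inter mM₁)).union
        ((mL₀.compl.inter mL₁).prod (mM₀.compl.inter mM₁.compl))) ?_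
    filter_upwards [hae] with x hx
    refine Set.indicator_apply_le' (fun hmem => ?_)
      fun _ => add_nonneg (E.joint_nonneg ..) (E.joint_nonneg ..)
    simp only [Set.mem_union, Set.mem_prod, Set.mem_inter_iff, Set.mem_compl_iff] at hmem
    have hB1 : E.condB 1 x.1 x.2 = 0 := by grind
    have hB0 : E.condB 0 x.1 x.2 = 1 := by linarith [sumB x]
    have hA : E.condA 2 0 x.1 = 0 := by grind
    have hC : E.condC 0 0 x.2 = 1 := by grind
    have := sumA 0 x.1
    simp only [EvansModel.joint, hB0, hC, Pi.one_apply, Pi.add_apply]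
    linarith
  · rw [E.observed_eq, ← rect, ← rect,
      ← measureReal_union (Set.disjoint_left.2 fun x hx hy => hy.1.2 hx.1.2)
      ((mL₀.inter mL₁.compl).prod (mM₀.inter mM₁))]
    refine measureReal_le_integral_of_ae_indicator_le (E.integrable_joint ..)
      (((mL₀.inter mL₁).prod (mM₀.inter mM₁.compl)).union
        ((mL₀.inter mL₁.compl).prod (mM₀.inter mM₁))) ?_
    filter_upwards [hae] with x hx
    refine Set.indicator_apply_le' (fun hmem => ?_) fun _ => E.joint_nonneg ..
    simp only [Set.mem_union, Set.mem_prod, Set.mem_inter_iff, Set.mem_compl_iff] at hmem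
    have hB1 : E.condB 1 x.1 x.2 = 0 := by grind
    have hB0 : E.condB 0 x.1 x.2 = 1 := by linarith [sumB x]
    have hA : E.condA 2 0 x.1 = 1 := by grind
    have hC : E.condC 1 0 x.2 = 1 := by grind
    simp [EvansModel.joint, hB0, hC, hA]
  -- The second bit is summed out; `(b, c) = (0, 1)` needs both first bits to be 1.
  · rw [← splitL _ _ mL₁, ← splitM _ _ mM₁, ← rect, E.observed_eq]
    refine integral_le_measureReal_of_ae_le_indicator (E.integrable_joint ..) (mL₀.prod mM₀) ?_
    filter_upwards [hae] with x hx
    refine Set.le_indicator_apply (fun _ => E.joint_le_one ..) fun hmem => le_of_eq ?_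
    simp only [Set.mem_prod] at hmem
    simp only [EvansModel.joint, mul_eq_zero]
    grind
  · rw [Set.inter_comm E.setL₀, Set.inter_comm E.setL₀ᶜ, Set.inter_comm (E.setM 0),
      Set.inter_comm (E.setM 0)ᶜ, ← splitL _ _ mL₀, ← splitM _ _ mM₀, ← rect, hv]
    refine integral_le_measureReal_of_ae_le_indicator
      ((E.integrable_joint ..).add (E.integrable_joint ..)) (mL₁.prod mM₁) ?_
    filter_upwards [hae] with x hx
    refine Set.le_indicator_apply (fun _ => ?_) fun hmem => le_of_eq ?_
    · have h0 := E.joint_nonneg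
      have h1 := E.sum_joint x
      simp only [Fin.sum_univ_three, Fin.sum_univ_two] at h1
      simp only [Pi.one_apply, Pi.add_apply]
      linarith [h0 0 0 0 x, h0 0 0 1 x, h0 0 1 0 x, h0 1 0 0 x, h0 1 0 1 x, h0 1 1 0 x,
        h0 1 1 1 x, h0 2 0 0 x, h0 2 0 1 x, h0 2 1 0 x]
    · simp only [Set.mem_prod] at hmem
      have : E.condB 1 x.1 x.2 = 0 ∨ E.condC 1 1 x.2 = 0 := by grind
      rcases this with h | h <;> simp [EvansModel.joint, h]
  · rw [Set.inter_comm E.setL₀, Set.inter_comm E.setL₀ᶜ, Set.inter_comm (E.setM 0),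
      Set.inter_comm (E.setM 0)ᶜ, ← splitL _ _ mL₀, ← splitM _ _ mM₀, ← rect, E.observed_eq]
    refine integral_le_measureReal_of_ae_le_indicator (E.integrable_joint ..)
      (mL₁.compl.prod mM₁.compl) ?_
    filter_upwards [hae] with x hx
    refine Set.le_indicator_apply (fun _ => E.joint_le_one ..) fun hmem => le_of_eq ?_
    simp only [Set.mem_prod, Set.mem_compl_iff] at hmem
    have := sumC 1 x.2
    simp only [EvansModel.joint, mul_eq_zero]
    grind

/-! ### Relabelling symmetry -/

/-- The classical model in which the outcomes `1` and `2` of `A` are exchanged and `B` and `C` are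
flipped. -/
def EvansModel.relabelled {L M : Type*} [MeasurableSpace L] [MeasurableSpace M]
    (E : EvansModel L M) : EvansModel L M where
  lawL := E.lawL
  lawM := E.lawM
  condA a b := E.condA (Equiv.swap 1 2 a) (b + 1)
  condB b := E.condB (b + 1)
  condC c b := E.condC (c + 1) (b + 1)
  measurable_condA _ _ := E.measurable_condA _ _
  measurable_condB _ := E.measurable_condB _
  measurable_condC _ _ := E.measurable_condC _ _
  condA_nonneg _ _ _ := E.condA_nonneg _ _ _
  condB_nonneg _ _ _ := E.condB_nonneg _ _ _
  condC_nonneg _ _ _ := E.condC_nonneg _ _ _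
  condA_sum b l := by
    rw [← E.condA_sum (b + 1) l]
    exact Equiv.sum_comp (Equiv.swap (1 : Fin 3) 2) fun a => E.condA a (b + 1) l
  condB_sum l m := by
    rw [← E.condB_sum l m]
    exact Equiv.sum_comp (Equiv.addRight (1 : Fin 2)) fun b => E.condB b l m
  condC_sum b m := by
    rw [← E.condC_sum (b + 1) m]
    exact Equiv.sum_comp (Equiv.addRight (1 : Fin 2)) fun c => E.condC c (b + 1) m

lemma HasClassicalEvansModel.relabel.{u₁, v₁} {p : Fin 3 → Fin 2 → Fin 2 → ℝ}
    (h : HasClassicalEvansModel.{u₁, v₁} p) : HasClassicalEvansModel.{u₁, v₁} (relabel p) := by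
  obtain ⟨L, M, _, _, E, hE⟩ := h
  exact ⟨L, M, _, _, E.relabelled, fun a b c => hE _ _ _⟩

lemma HasClassicalEvansModel.cubicWitness_le.{u₁, v₁} {p : Fin 3 → Fin 2 → Fin 2 → ℝ}
    (h : HasClassicalEvansModel.{u₁, v₁} p) (hp : SupportedOnBonet p) :
    cubicWitness p ≤ 1 / 3 := by
  obtain ⟨L, M, _, _, E, hE⟩ := h
  obtain rfl : p = E.observed := by
    funext a b c
    exact hE a b c
  exact E.cubicWitness_observed_le hp

lemma SupportedOnBonet.relabel {p : Fin 3 → Fin 2 → Fin 2 → ℝ} (h : SupportedOnBonet p) :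
    SupportedOnBonet (relabel p) := by
  have h0 : Equiv.swap (1 : Fin 3) 2 0 = 0 := by decide
  rw [supportedOnBonet_iff] at h ⊢
  simp only [_root_.relabel, h0, Equiv.swap_apply_left, Equiv.swap_apply_right, zero_add,
    show (1 : Fin 2) + 1 = 0 from rfl]
  linarith

/-! ### Evaluation on the Bonet PR-box -/

lemma bonetDist_isProbDist {pA : Fin 3 → ℝ} (h : ∀ a, 0 ≤ pA a) (hs : ∑ a, pA a = 1) :
    IsProbDist (bonetDist pA) := by
  refine ⟨fun a b c => mul_nonneg (h a) (by unfold bonetBox; split_ifs <;> norm_num), ?_⟩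
  rw [← hs]
  refine Finset.sum_congr rfl fun a _ => ?_
  simp only [bonetDist, ← Finset.mul_sum, bonetBox, Finset.sum_ite_eq', Finset.mem_univ, if_true]
  norm_num

lemma bonetDist_apply_bonetF (pA : Fin 3 → ℝ) (a : Fin 3) (b : Fin 2) :
    bonetDist pA a b (bonetF a b + b) = pA a / 2 := by
  simp [bonetDist, bonetBox, add_comm, div_eq_mul_inv]

lemma bonetDist_supportedOnBonet {pA : Fin 3 → ℝ} (hs : ∑ a, pA a = 1) :
    SupportedOnBonet (bonetDist pA) := by
  simp only [SupportedOnBonet, bonetDist_apply_bonetF, Fin.sum_univ_two, add_halves, hs]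

lemma cubicWitness_bonetDist {pA : Fin 3 → ℝ} (hs : ∑ a, pA a = 1) :
    cubicWitness (bonetDist pA) = 1 / 3 - 1 / 6 * (pA 2 * (pA 2 ^ 2 + 2 * (pA 0 + pA 1) * pA 2 -
      2 * (pA 0 + pA 2) * pA 1)) := by
  have h := bonetDist_apply_bonetF pA
  rw [cubicWitness_eq (bonetDist_supportedOnBonet hs), show bonetDist pA 0 0 0 = _ from h 0 0,
    show bonetDist pA 0 1 1 = _ from h 0 1, show bonetDist pA 1 0 0 = _ from h 1 0,
    show bonetDist pA 1 1 0 = _ from h 1 1, show bonetDist pA 2 0 1 = _ from h 2 0,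
    show bonetDist pA 2 1 1 = _ from h 2 1]
  ring

lemma relabel_bonetDist (pA : Fin 3 → ℝ) :
    relabel (bonetDist pA) = bonetDist (pA ∘ Equiv.swap 1 2) := by
  have hbox : ∀ a b c, bonetBox (b + 1) (c + 1) (Equiv.swap 1 2 a) = bonetBox b c a := by
    intro a b c
    have : (c + 1 = b + 1 + bonetF (Equiv.swap 1 2 a) (b + 1)) ↔ (c = b + bonetF a b) := by
      revert a b c
      decide
    simp only [bonetBox, this]
  funext a b c
  simp only [relabel, bonetDist, hbox, Function.comp_apply]

theorem mainTheorem1 :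
    -- the inequality, and its image under the relabelling, for all classical distributions
    (∀ p : Fin 3 → Fin 2 → Fin 2 → ℝ, HasClassicalEvansModel.{u, v} p → SupportedOnBonet p →
      cubicWitness p ≤ 1 / 3 ∧ cubicWitness (relabel p) ≤ 1 / 3) ∧
    -- the PR-box with `pA = (10/21, 10/21, 1/21)`
    (IsProbDist (bonetDist ![10 / 21, 10 / 21, 1 / 21]) ∧
      SupportedOnBonet (bonetDist ![10 / 21, 10 / 21, 1 / 21]) ∧
      cubicWitness (bonetDist ![10 / 21, 10 / 21, 1 / 21]) - 1 / 3 = 179 / 55566 ∧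
      ¬ HasClassicalEvansModel.{u, v} (bonetDist ![10 / 21, 10 / 21, 1 / 21])) ∧
    -- the PR-box with `pA = (10/21, 1/21, 10/21)`
    (IsProbDist (bonetDist ![10 / 21, 1 / 21, 10 / 21]) ∧
      SupportedOnBonet (bonetDist ![10 / 21, 1 / 21, 10 / 21]) ∧
      cubicWitness (relabel (bonetDist ![10 / 21, 1 / 21, 10 / 21])) - 1 / 3 = 179 / 55566 ∧
      ¬ HasClassicalEvansModel.{u, v} (bonetDist ![10 / 21, 1 / 21, 10 / 21])) ∧
    -- the size of the violation
    |(179 / 55566 : ℝ) - 3.2e-3| ≤ 0.05e-3 := by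
  have hs₁ : ∑ a, (![10 / 21, 10 / 21, 1 / 21] : Fin 3 → ℝ) a = 1 := by
    simp [Fin.sum_univ_three]; norm_num
  have hs₂ : ∑ a, (![10 / 21, 1 / 21, 10 / 21] : Fin 3 → ℝ) a = 1 := by
    simp [Fin.sum_univ_three]; norm_num
  have hB₁ := bonetDist_supportedOnBonet hs₁
  have hB₂ := bonetDist_supportedOnBonet hs₂
  have hw₁ : cubicWitness (bonetDist ![10 / 21, 10 / 21, 1 / 21]) - 1 / 3 = 179 / 55566 := by
    rw [cubicWitness_bonetDist hs₁]
    simp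
    norm_num
  have hswap : (![10 / 21, 1 / 21, 10 / 21] : Fin 3 → ℝ) ∘ Equiv.swap 1 2 =
      ![10 / 21, 10 / 21, 1 / 21] := by
    funext a
    fin_cases a <;> rfl
  have hw₂ : cubicWitness (relabel (bonetDist ![10 / 21, 1 / 21, 10 / 21])) - 1 / 3 =
      179 / 55566 := by
    rw [relabel_bonetDist, hswap, hw₁]
  refine ⟨fun p hp hB => ⟨hp.cubicWitness_le hB, hp.relabel.cubicWitness_le hB.relabel⟩,
    ⟨bonetDist_isProbDist ?_ hs₁, hB₁, hw₁, fun h => ?_⟩,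
    ⟨bonetDist_isProbDist ?_ hs₂, hB₂, hw₂, fun h => ?_⟩, ?_⟩
  · intro a; fin_cases a <;> norm_num
  · linarith [h.cubicWitness_le hB₁]
  · intro a; fin_cases a <;> norm_num
  · linarith [h.relabel.cubicWitness_le hB₂.relabel]
  · rw [abs_le]; norm_num
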